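/- Let $I$ be a finite set and let $\Delta$ be a right-angled building of type $M=(m_{ij})_{i,j\in I}$ (so $m_{ij}\in\{2,\infty\}$ for all $i\neq j$), viewed as a chamber system, whose Coxeter diagram has no isolated nodes: for every $i\in I$ there is $j\in I$ with $m_{ij}=\infty$. For each $i\in I$ let $X_i$ be a set and let $F_i\leq\mathrm{Sym}(X_i)$ be a permutation group (not necessarily transitive, closed, or of finite degree). Assume that $\Delta$ is semiregular with parameters $(|X_i|)_{i\in I}$, i.e. every $i$-panel has cardinality $|X_i|$ (necessarily $|X_i|\geq 2$), and let $\lambda=(\lambda_i)_{i\in I}\colon\Delta\to\prod_{i\in I}X_i$ be a legal colouring: for every $i$-panel $\mathcal P$, the restriction $\lambda_i|_{\mathcal P}\colon\mathcal P\to X_i$ is a bijection, and $\lambda_j|_{\mathcal P}$ is constant for every $j\neq i$. Let $$U(\boldsymbol F)=\{g\in\mathrm{Aut}(\Delta)\mid \lambda_i|_{g\mathcal P}\circ g|_{\mathcal P}\circ(\lambda_i|_{\mathcal P})^{-1}\in F_i\text{ for every } i\in I\text{ and every } i\text{-panel }\mathcal P\}$$ be the universal group, where $\mathrm{Aut}(\Delta)$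 is the group of type-preserving automorphisms. Endow $\mathrm{Aut}(\Delta)$ and its subgroups with the permutation topology, in which the pointwise stabilisers of finite sets of chambers form a neighbourhood basis of the identity. Assume that $U(\boldsymbol F)$ is closed in $\mathrm{Aut}(\Delta)$, locally compact, and compactly generated (i.e. generated as a group by a compact subset). Then for every $i\in I$ the local group $F_i$ has only finitely many orbits on $X_i$. -/

import Mathlib

/-- The permutation topology on `Sym(X)`: a set is open when it contains, with each element `g`, the
coset `g · Sym(X)_(Φ)` of the pointwise stabiliser of some finite set `Φ ⊆ X`. Subgroups of
`Sym(X)` carry the subspace topology, which is their own permutation topology. -/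
instance permTopology (X : Type*) : TopologicalSpace (Equiv.Perm X) where
  IsOpen U := ∀ g ∈ U, ∃ Φ : Finset X, ∀ h : Equiv.Perm X, (∀ x ∈ Φ, h x = x) → g * h ∈ U
  isOpen_univ := fun _ _ => ⟨∅, fun _ _ => Set.mem_univ _⟩
  isOpen_inter := by
    classical
    intro U V hU hV g hg
    obtain ⟨Φ, hΦ⟩ := hU g hg.1
    obtain ⟨Ψ, hΨ⟩ := hV g hg.2
    exact ⟨Φ ∪ Ψ, fun h hh => ⟨hΦ h fun x hx => hh x (Finset.mem_union_left _ hx),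
      hΨ h fun x hx => hh x (Finset.mem_union_right _ hx)⟩⟩
  isOpen_sUnion := by
    intro S hS g hg
    obtain ⟨U, hU, hgU⟩ := hg
    obtain ⟨Φ, hΦ⟩ := hS U hU g hgU
    exact ⟨Φ, fun h hh => ⟨U, hU, hΦ h hh⟩⟩

/-- A topological group is compactly generated if some compact subset generates it as a group. -/
def IsCompactlyGeneratedGroup (G : Type*) [Group G] [TopologicalSpace G] : Prop :=
  ∃ K : Set G, IsCompact K ∧ Subgroup.closure K = ⊤

/-- A chamber system over `I` with set of chambers `C`: for every `i ∈ I` an equivalence relation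
on the chambers, called `i`-adjacency. -/
structure ChamberSystem (I C : Type*) where
  adj : I → Setoid C

namespace ChamberSystem

variable {I C : Type*} (Δ : ChamberSystem I C)

/-- The `i`-panel containing the chamber `c`, that is, its class under `i`-adjacency. Every
`i`-panel is of this form. -/
def panel (i : I) (c : C) : Set C := {d | (Δ.adj i).r c d}

/-- `Δ.IsGallery ω x y`: there is a gallery from `x` to `y` of type `ω`, i.e. a sequence of chambers
with consecutive ones distinct and `i`-adjacent for the respective letter `i` of `ω`. -/
def IsGallery : List I → C → C → Prop
  | [], x, y => x = y
  | i :: ω, x, y => ∃ z, z ≠ x ∧ (Δ.adj i).r x z ∧ IsGallery ω z y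

/-- `Δ` is a building of type `M`: it has at least one chamber, every panel has at least two
chambers, and there is a distance function `δ` with values in the Coxeter group `W` of type `M`
such that, for every reduced word `ω`, one has `δ x y = r_ω` if and only if `x` and `y` are joined
by a gallery of type `ω`. -/
def IsBuilding (M : CoxeterMatrix I) : Prop :=
  Nonempty C ∧ (∀ i c, ∃ d ∈ Δ.panel i c, d ≠ c) ∧
    ∃ δ : C → C → M.Group, ∀ ω : List I, M.toCoxeterSystem.IsReduced ω →
      ∀ x y : C, δ x y = M.toCoxeterSystem.wordProd ω ↔ Δ.IsGallery ω x y

/-- The group `Aut(Δ)` of (type-preserving) automorphisms of `Δ`. -/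
def aut : Subgroup (Equiv.Perm C) where
  carrier := {g | ∀ i c d, (Δ.adj i).r (g c) (g d) ↔ (Δ.adj i).r c d}
  mul_mem' := by
    intro g h hg hh i c d
    exact (hg i (h c) (h d)).trans (hh i c d)
  one_mem' := fun _ _ _ => Iff.rfl
  inv_mem' := by
    intro g hg i c d
    have := hg i (g⁻¹ c) (g⁻¹ d)
    simpa using this.symm

/-- An automorphism maps the `i`-panel of `c` bijectively onto the `i`-panel of its image. -/
def panelMap (g : Δ.aut) (i : I) (c : C) : Δ.panel i c ≃ Δ.panel i (g.1 c) :=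
  g.1.subtypeEquiv fun d => (g.2 i c d).symm

/-- A legal colouring of `Δ` with colour sets `X i`: on each `i`-panel, the `i`-th colour is a
bijection to `X i` and every other colour is constant. (In particular all `i`-panels have
cardinality `|X i|`, that is, `Δ` is semiregular with parameters `|X i|`.) -/
structure LegalColouring (X : I → Type*) where
  colour : C → (i : I) → X i
  bijective_panel : ∀ i c, Function.Bijective fun d : Δ.panel i c => colour d i
  constant_panel : ∀ i j, j ≠ i → ∀ c, ∀ d ∈ Δ.panel i c, colour d j = colour c j

namespace LegalColouring

variable {Δ} {X : I → Type*} (col : Δ.LegalColouring X)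

/-- The bijection from the `i`-panel of `c` to `X i` given by the `i`-th colour. -/
noncomputable def panelEquiv (i : I) (c : C) : Δ.panel i c ≃ X i :=
  Equiv.ofBijective (fun d => col.colour d i) (col.bijective_panel i c)

/-- The local action `σ(g, P) = λ_i|_{gP} ∘ g|_P ∘ (λ_i|_P)⁻¹` of an automorphism `g` at the
`i`-panel `P` of `c`. -/
noncomputable def localAction (g : Δ.aut) (i : I) (c : C) : Equiv.Perm (X i) :=
  ((col.panelEquiv i c).symm.trans (Δ.panelMap g i c)).trans (col.panelEquiv i (g.1 c))

theorem localAction_colour (g : Δ.aut) (i : I) (c d : C) (hd : d ∈ Δ.panel i c) :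
    col.localAction g i c (col.colour d i) = col.colour (g.1 d) i := by
  have h : (col.panelEquiv i c).symm (col.colour d i) = ⟨d, hd⟩ :=
    (Equiv.symm_apply_eq _).2 rfl
  simp only [localAction, Equiv.trans_apply, h]
  rfl

theorem localAction_ext {g : Δ.aut} {i : I} {c : C} {f : Equiv.Perm (X i)}
    (h : ∀ d ∈ Δ.panel i c, col.colour (g.1 d) i = f (col.colour d i)) :
    col.localAction g i c = f := by
  ext x
  obtain ⟨⟨d, hd⟩, rfl⟩ := (col.bijective_panel i c).2 x
  exact (col.localAction_colour g i c d hd).trans (h d hd)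

theorem localAction_one (i : I) (c : C) : col.localAction 1 i c = 1 :=
  col.localAction_ext fun _ _ => rfl

theorem localAction_mul (g h : Δ.aut) (i : I) (c : C) :
    col.localAction (g * h) i c = col.localAction g i (h.1 c) * col.localAction h i c := by
  refine col.localAction_ext fun d hd => ?_
  rw [Equiv.Perm.mul_apply, col.localAction_colour h i c d hd,
    col.localAction_colour g i (h.1 c) (h.1 d) ((h.2 i c d).2 hd)]
  rfl

theorem localAction_inv (g : Δ.aut) (i : I) (c : C) :
    col.localAction g⁻¹ i c = (col.localAction g i ((g⁻¹).1 c))⁻¹ := by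
  have h := col.localAction_mul g g⁻¹ i c
  rw [mul_inv_cancel, localAction_one] at h
  exact eq_inv_of_mul_eq_one_right h.symm

/-- The universal group `U(F)`: all automorphisms of `Δ` whose local action at every `i`-panel lies
in the local group `F i ≤ Sym(X i)`, for all `i`. -/
noncomputable def universalGroup (F : (i : I) → Subgroup (Equiv.Perm (X i))) :
    Subgroup Δ.aut where
  carrier := {g | ∀ i c, col.localAction g i c ∈ F i}
  mul_mem' := by
    intro g h hg hh i c
    rw [localAction_mul]
    exact (F i).mul_mem (hg i _) (hh i c)
  one_mem' := by
    intro i c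
    rw [localAction_one]
    exact (F i).one_mem
  inv_mem' := by
    intro g hg i c
    rw [localAction_inv]
    exact (F i).inv_mem (hg i _)

end LegalColouring

end ChamberSystem

/-- A Coxeter matrix is right-angled if `m i j ∈ {2, ∞}` for all `i ≠ j`. (In a Mathlib
`CoxeterMatrix`, the entry `0` stands for `∞`.) -/
def CoxeterMatrix.IsRightAngled {I : Type*} (M : CoxeterMatrix I) : Prop :=
  ∀ i j, i ≠ j → M i j = 2 ∨ M i j = 0

/-- The Coxeter diagram of `M` has no isolated nodes: every `i` is joined by an edge to some
`j ≠ i`, i.e. `m i j ≠ 2`. -/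
def CoxeterMatrix.HasNoIsolatedNodes {I : Type*} (M : CoxeterMatrix I) : Prop :=
  ∀ i, ∃ j, j ≠ i ∧ M i j ≠ 2

/-!
The chambers of a legally coloured right-angled building can be moved by prescribing a new `i`-th
colour; the moves of commuting types commute. By Tits' solution of the word problem, every closed
walk made of such moves reduces to the trivial walk by these commutations and the relations inside
a panel, so the building maps to every system with moves satisfying the same relations. Mapping it
to itself gives, for any two chambers with the same colours, a colour-preserving automorphism
between them; it belongs to `U(F)` for every choice of `F`. Mapping it to a covering by an abelian
group gives height functions whose variation along `i`-adjacent chambers is prescribed by the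
`i`-th and the `j`-th colour, where `m i j = ∞`.

Suppose that `U(F)` is generated by a compact set `K`. For a chamber `c`, the set `K c` is finite,
and all its elements are joined to `c` by galleries involving only finitely many `i`-th colours. If
`F i` has infinitely many orbits, one of them, `O`, avoids those colours. As `U(F)` permutes the
chambers with `i`-th colour in `O`, the whole orbit of `c` is then joined to `c` by galleries
avoiding `O`. But a height function produces a chamber with the same colours as `c`, hence in the
orbit of `c`, that is not joined to `c` in this way.
-/

theorem rel_smul_of_closure_eq_top {G X : Type*} [Group G] [MulAction G X] {K : Set G}
    (hK : Subgroup.closure K = ⊤) {r : Setoid X} (hr : ∀ (g : G) x y, r x y → r (g • x) (g • y))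
    {x : X} (hx : ∀ k ∈ K, r x (k • x)) (g : G) : r x (g • x) := by
  have hg : g ∈ Subgroup.closure K := hK ▸ Subgroup.mem_top g
  induction hg using Subgroup.closure_induction with
  | mem k hk => exact hx k hk
  | one => simpa only [one_smul] using r.refl' x
  | mul g h _ _ ihg ihh => exact r.trans' ihg (mul_smul g h x ▸ hr g _ _ ihh)
  | inv g _ ih => simpa only [inv_smul_smul] using r.symm' (hr g⁻¹ _ _ ih)

theorem isOpen_setOf_perm_apply_eq {X : Type*} (x y : X) :
    IsOpen {g : Equiv.Perm X | g x = y} := by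
  refine fun g hg => ⟨{x}, fun h hh => ?_⟩
  calc g (h x) = g x := by rw [hh x (Finset.mem_singleton_self x)]
    _ = y := hg

theorem finite_image_apply_of_isCompact {X : Type*} {K : Set (Equiv.Perm X)} (hK : IsCompact K)
    (x : X) : ((fun g => g x) '' K).Finite := by
  let _ : TopologicalSpace X := ⊥
  have : DiscreteTopology X := ⟨rfl⟩
  have hcont : Continuous fun g : Equiv.Perm X => g x :=
    continuous_discrete_rng.2 fun y => isOpen_setOf_perm_apply_eq x y
  exact (hK.image hcont).finite_of_discrete

namespace RightAngledCoxeter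

variable {I : Type*}

/-- The letter `i` occurs in the word `ω`, and all letters before that occurrence commute with `i`,
so that `i` can be moved to the front by commutations. -/
inductive CommutesToFront (M : CoxeterMatrix I) (i : I) : List I → Prop
  | head (ω : List I) : CommutesToFront M i (i :: ω)
  | cons {k : I} {ω : List I} (hk : M i k = 2) (hω : CommutesToFront M i ω) :
      CommutesToFront M i (k :: ω)

theorem ne_of_apply_eq_two {M : CoxeterMatrix I} {i j : I} (hij : M i j = 2) : i ≠ j := by
  rintro rfl
  simp at hij

/-- The entry `2 ⟨αᵢ, αⱼ⟩ = -2 cos (π / m i j)` of the Cartan matrix of a right-angled Coxeter group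
as a function of `m i j ∈ {1, 2, ∞}`, with `∞` encoded as `0`. -/
def cartanEntry : ℕ → ℤ
  | 0 => -2
  | 1 => 2
  | _ => 0

/-- The simple reflection attached to `i` in the contragredient of the geometric representation of
a right-angled Coxeter group, where `v j` is the value of the functional `v` at the `j`-th simple
root. -/
def reflect (M : CoxeterMatrix I) (i : I) : Function.End (I → ℤ) :=
  fun v j => v j - cartanEntry (M i j) * v i

section Reflect

variable (M : CoxeterMatrix I)

theorem reflect_apply_self (i : I) (v : I → ℤ) : reflect M i v i = -v i := by
  rw [reflect, M.diagonal, cartanEntry]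
  ring

theorem reflect_mul_self (i : I) : reflect M i * reflect M i = 1 := by
  funext v j
  change reflect M i v j - cartanEntry (M i j) * reflect M i v i = v j
  rw [reflect_apply_self, reflect]
  ring

variable {M}

theorem reflect_mul_comm {i j : I} (hij : M i j = 2) :
    reflect M i * reflect M j = reflect M j * reflect M i := by
  have hji : M j i = 2 := M.symmetric i j ▸ hij
  funext v k
  change reflect M j v k - cartanEntry (M i k) * reflect M j v i =
    reflect M i v k - cartanEntry (M j k) * reflect M i v j
  simp only [reflect, hij, hji, cartanEntry]
  ring

theorem isLiftable_reflect (hM : M.IsRightAngled) : M.IsLiftable (reflect M) := by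
  intro i j
  obtain rfl | hne := eq_or_ne i j
  · rw [reflect_mul_self, one_pow]
  obtain hij | hij := hM i j hne
  · rw [hij, pow_two, mul_assoc, ← mul_assoc (reflect M j), ← reflect_mul_comm hij,
      mul_assoc (reflect M i), reflect_mul_self, mul_one, reflect_mul_self]
  · rw [hij, pow_zero]

/-- No coordinate of `v` vanishes, and of two coordinates joined by an edge of the Coxeter diagram
at most one is negative, the other one then having the larger absolute value. The translates of the
vector `(1, 1, …)` under a right-angled Coxeter group have this property. -/
def IsGeneric (M : CoxeterMatrix I) (v : I → ℤ) : Prop :=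
  (∀ j, v j ≠ 0) ∧ ∀ j k, M j k = 0 → 0 < v j + v k

theorem eq_or_reflect_apply (hM : M.IsRightAngled) (i j : I) (v : I → ℤ) :
    i = j ∨ (M i j = 2 ∧ reflect M i v j = v j) ∨
      (M i j = 0 ∧ reflect M i v j = v j + 2 * v i) := by
  obtain rfl | hne := eq_or_ne i j
  · exact Or.inl rfl
  exact Or.inr ((hM i j hne).imp (fun h => ⟨h, by simp [reflect, h, cartanEntry]⟩)
    fun h => ⟨h, by simp [reflect, h, cartanEntry]⟩)

theorem IsGeneric.reflect_of_pos (hM : M.IsRightAngled) {v : I → ℤ} (hv : IsGeneric M v) {i : I}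
    (hi : 0 < v i) : IsGeneric M (reflect M i v) := by
  have hself := reflect_apply_self M i v
  refine ⟨fun j => ?_, fun j k hjk => ?_⟩
  · have hj := hv.1 j
    obtain rfl | ⟨-, h⟩ | ⟨hij, h⟩ := eq_or_reflect_apply hM i j v
    · omega
    · omega
    · have := hv.2 i j hij
      omega
  · have hsum := hv.2 j k hjk
    have hkj : M k j = 0 := M.symmetric j k ▸ hjk
    have hne : j ≠ k := by
      rintro rfl
      simp at hjk
    obtain rfl | ⟨_, hj⟩ | ⟨-, hj⟩ := eq_or_reflect_apply hM i j v <;>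
    obtain rfl | ⟨_, hk⟩ | ⟨-, hk⟩ := eq_or_reflect_apply hM i k v <;>
    first
      | omega
      | contradiction

theorem IsGeneric.eq_or_neg_of_reflect_neg (hM : M.IsRightAngled) {v : I → ℤ}
    (hv : IsGeneric M v) {i j : I} (hi : 0 < v i) (hj : reflect M i v j < 0) :
    i = j ∨ (M i j = 2 ∧ v j < 0) := by
  obtain h | ⟨hij, h⟩ | ⟨hij, h⟩ := eq_or_reflect_apply hM i j v
  · exact Or.inl h
  · exact Or.inr ⟨hij, h ▸ hj⟩
  · have := hv.2 i j hij
    omega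

end Reflect

section CoxeterSystem

variable {M : CoxeterMatrix I} {W : Type*} [Group W] (cs : CoxeterSystem M W)

theorem simple_mul_comm {i j : I} (hij : M i j = 2) :
    cs.simple i * cs.simple j = cs.simple j * cs.simple i := by
  have h := cs.simple_mul_simple_pow i j
  rwa [hij, pow_two, mul_eq_one_iff_eq_inv, mul_inv_rev, cs.inv_simple, cs.inv_simple] at h

variable {cs}

theorem isReduced_cons_iff {i : I} {ω : List I} (hω : cs.IsReduced ω) :
    cs.IsReduced (i :: ω) ↔ ¬ cs.IsLeftDescent (cs.wordProd ω) i := by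
  rw [cs.not_isLeftDescent_iff, hω.eq, CoxeterSystem.IsReduced, cs.wordProd_cons, List.length_cons]

variable (cs)

theorem CommutesToFront.exists_wordProd_eq {i : I} {ω : List I} (h : CommutesToFront M i ω) :
    ∃ ω', cs.wordProd ω = cs.simple i * cs.wordProd ω' ∧ ω.length = ω'.length + 1 := by
  induction h with
  | head ω => exact ⟨ω, cs.wordProd_cons i ω, rfl⟩
  | @cons k ω hk _ ih =>
    obtain ⟨ω', hprod, hlen⟩ := ih
    refine ⟨k :: ω', ?_, congrArg (· + 1) hlen⟩
    rw [cs.wordProd_cons, cs.wordProd_cons, hprod, ← mul_assoc, ← mul_assoc,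
      simple_mul_comm cs hk]

theorem CommutesToFront.isLeftDescent {i : I} {ω : List I} (h : CommutesToFront M i ω)
    (hω : cs.IsReduced ω) : cs.IsLeftDescent (cs.wordProd ω) i := by
  obtain ⟨ω', hprod, hlen⟩ := h.exists_wordProd_eq cs
  rw [CoxeterSystem.IsLeftDescent, hω.eq, hprod, cs.simple_mul_simple_cancel_left, hlen]
  exact Nat.lt_succ_of_le (cs.length_wordProd_le ω')

/-- The image of the vector `(1, 1, …)` under an element of a right-angled Coxeter group, in the
contragredient of the geometric representation. Its negative coordinates are the left descents. -/
noncomputable def weylVector (hM : M.IsRightAngled) (w : W) : I → ℤ :=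
  cs.lift ⟨reflect M, isLiftable_reflect hM⟩ w fun _ => 1

theorem weylVector_one (hM : M.IsRightAngled) : weylVector cs hM 1 = fun _ => 1 := by
  rw [weylVector, map_one]
  rfl

theorem weylVector_simple_mul (hM : M.IsRightAngled) (i : I) (w : W) :
    weylVector cs hM (cs.simple i * w) = reflect M i (weylVector cs hM w) := by
  rw [weylVector, map_mul, cs.lift_apply_simple]
  rfl

variable {cs}

theorem isGeneric_weylVector_wordProd (hM : M.IsRightAngled) {ω : List I}
    (hω : cs.IsReduced ω) :
    IsGeneric M (weylVector cs hM (cs.wordProd ω)) ∧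
      ∀ i, weylVector cs hM (cs.wordProd ω) i < 0 → CommutesToFront M i ω := by
  induction ω with
  | nil => simp [IsGeneric, weylVector_one]
  | cons i ω ih =>
    have hω' : cs.IsReduced ω := hω.drop 1
    obtain ⟨hgen, hfront⟩ := ih hω'
    have hpos : 0 < weylVector cs hM (cs.wordProd ω) i := by
      refine (hgen.1 i).symm.lt_of_le (not_lt.1 fun hneg => ?_)
      exact (isReduced_cons_iff hω').1 hω ((hfront i hneg).isLeftDescent cs hω')
    rw [cs.wordProd_cons, weylVector_simple_mul]
    refine ⟨hgen.reflect_of_pos hM hpos, fun j hj => ?_⟩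
    obtain rfl | ⟨hij, hneg⟩ := hgen.eq_or_neg_of_reflect_neg hM hpos hj
    · exact .head ω
    · exact .cons (M.symmetric i j ▸ hij) (hfront j hneg)

theorem weylVector_neg_of_isLeftDescent (hM : M.IsRightAngled) {w : W} {i : I}
    (h : cs.IsLeftDescent w i) : weylVector cs hM w i < 0 := by
  obtain ⟨u, hu, hwu⟩ := cs.exists_isReduced (cs.simple i * w)
  obtain ⟨hgen, hfront⟩ := isGeneric_weylVector_wordProd hM hu
  have hnot : ¬ CommutesToFront M i u := fun hi =>
    cs.isLeftDescent_iff_not_isLeftDescent_mul.1 h (hwu ▸ hi.isLeftDescent cs hu)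
  have hpos := (hgen.1 i).symm.lt_of_le (not_lt.1 (mt (hfront i) hnot))
  rw [← hwu, weylVector_simple_mul, reflect_apply_self] at hpos
  exact neg_pos.1 hpos

theorem commutesToFront_of_isLeftDescent (hM : M.IsRightAngled) {i : I} {ω : List I}
    (hω : cs.IsReduced ω) (h : cs.IsLeftDescent (cs.wordProd ω) i) : CommutesToFront M i ω :=
  (isGeneric_weylVector_wordProd hM hω).2 i (weylVector_neg_of_isLeftDescent hM h)

theorem exists_commutesToFront_of_not_isReduced (hM : M.IsRightAngled) {ω : List I}
    (hω : ¬ cs.IsReduced ω) :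
    ∃ α i β, ω = α ++ i :: β ∧ CommutesToFront M i β := by
  induction ω with
  | nil => simp [CoxeterSystem.IsReduced] at hω
  | cons i ω ih =>
    by_cases hω' : cs.IsReduced ω
    · rw [isReduced_cons_iff hω', not_not] at hω
      exact ⟨[], i, ω, rfl, commutesToFront_of_isLeftDescent hM hω' hω⟩
    · obtain ⟨α, j, β, rfl, hβ⟩ := ih hω'
      exact ⟨i :: α, j, β, rfl, hβ⟩

theorem isReduced_pair (hM : M.IsRightAngled) {i j : I} (hij : i ≠ j) : cs.IsReduced [i, j] := by
  have hj : cs.IsReduced [j] := by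
    rw [CoxeterSystem.IsReduced, cs.wordProd_singleton, cs.length_simple, List.length_singleton]
  refine (isReduced_cons_iff hj).2 fun hdesc => ?_
  cases commutesToFront_of_isLeftDescent hM hj hdesc with
  | head => exact hij rfl
  | cons _ h => cases h

end CoxeterSystem

end RightAngledCoxeter

/-- A set of states with colours in which the colour of any type `i` can be changed at will, subject
to the relations that hold when the states are the chambers of a legally coloured right-angled
building and `move s i x` is the chamber with `i`-th colour `x` in the `i`-panel of `s`. -/
structure ColouredSystem {I : Type*} (M : CoxeterMatrix I) (X : I → Type*) (S : Type*) where
  colour : S → (i : I) → X i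
  move : S → (i : I) → X i → S
  colour_move_same : ∀ s i x, colour (move s i x) i = x
  colour_move_of_ne : ∀ s i j x, j ≠ i → colour (move s i x) j = colour s j
  move_colour : ∀ s i, move s i (colour s i) = s
  move_move : ∀ s i x y, move (move s i x) i y = move s i y
  move_comm : ∀ s i j x y, M i j = 2 → move (move s i x) j y = move (move s j y) i x

namespace ColouredSystem

open RightAngledCoxeter

variable {I : Type*} {M : CoxeterMatrix I} {X : I → Type*} {S T R : Type*}
  (A : ColouredSystem M X S) (B : ColouredSystem M X T) (D : ColouredSystem M X R)

section Walk

/-- The state reached from `s` by the moves listed in `w`. -/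
def walk (s : S) (w : List (Σ i, X i)) : S :=
  w.foldl (fun s l => A.move s l.1 l.2) s

theorem walk_nil (s : S) : A.walk s [] = s := rfl

theorem walk_cons (s : S) (l : Σ i, X i) (w : List (Σ i, X i)) :
    A.walk s (l :: w) = A.walk (A.move s l.1 l.2) w := rfl

theorem walk_append (s : S) (w w' : List (Σ i, X i)) :
    A.walk s (w ++ w') = A.walk (A.walk s w) w' := List.foldl_append

variable {A B} in
theorem colour_move_congr {s : S} {t : T} (h : A.colour s = B.colour t) (i : I) (x : X i) :
    A.colour (A.move s i x) = B.colour (B.move t i x) := by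
  funext j
  obtain rfl | hj := eq_or_ne j i
  · rw [A.colour_move_same, B.colour_move_same]
  · rw [A.colour_move_of_ne _ _ _ _ hj, B.colour_move_of_ne _ _ _ _ hj, h]

variable {A B} in
theorem colour_walk_congr {s : S} {t : T} (h : A.colour s = B.colour t) (w : List (Σ i, X i)) :
    A.colour (A.walk s w) = B.colour (B.walk t w) := by
  induction w generalizing s t with
  | nil => exact h
  | cons l _ ih => exact ih (colour_move_congr h l.1 l.2)

theorem colour_move_move_move_move {i j : I} (hji : j ≠ i) (s : S) (x : X i) (y : X j) :
    A.colour (A.move (A.move (A.move (A.move s i x) j y) i (A.colour s i)) j (A.colour s j)) =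
      A.colour s := by
  funext k
  obtain rfl | hk := eq_or_ne k j
  · rw [A.colour_move_same]
  rw [A.colour_move_of_ne _ _ _ _ hk]
  obtain rfl | hki := eq_or_ne k i
  · rw [A.colour_move_same]
  rw [A.colour_move_of_ne _ _ _ _ hki, A.colour_move_of_ne _ _ _ _ hk,
    A.colour_move_of_ne _ _ _ _ hki]

theorem walk_move_of_commutesToFront {i : I} {w : List (Σ i, X i)}
    (h : CommutesToFront M i (w.map Sigma.fst)) (s : S) (x : X i) :
    A.walk (A.move s i x) w = A.walk s w := by
  induction w generalizing s with
  | nil => cases h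
  | cons l w ih =>
    rw [walk_cons, walk_cons]
    obtain ⟨k, y⟩ := l
    cases h with
    | head => rw [A.move_move]
    | cons hk h => rw [A.move_comm _ _ _ _ _ hk, ih h]

/-- The move `l` followed by the moves in `w` can be omitted in the state `s`: it does not change
`s`, or it is overridden by a later move of the same type with which it can be brought together. -/
def IsRedundant (s : S) (l : Σ i, X i) (w : List (Σ i, X i)) : Prop :=
  A.colour s l.1 = l.2 ∨ CommutesToFront M l.1 (w.map Sigma.fst)

variable {A B} in
theorem IsRedundant.congr {s : S} {t : T} {l : Σ i, X i} {w : List (Σ i, X i)}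
    (h : A.IsRedundant s l w) (hst : A.colour s = B.colour t) : B.IsRedundant t l w :=
  h.imp_left fun hl => hst ▸ hl

variable {A} in
theorem IsRedundant.walk_cons {s : S} {l : Σ i, X i} {w : List (Σ i, X i)}
    (h : A.IsRedundant s l w) : A.walk s (l :: w) = A.walk s w := by
  rw [A.walk_cons]
  obtain hl | hl := h
  · rw [← hl, A.move_colour]
  · exact A.walk_move_of_commutesToFront hl s l.2

end Walk

/-- The maps between two coloured systems that preserve colours and moves. -/
structure Hom where
  toFun : S → T
  colour_toFun : ∀ s, B.colour (toFun s) = A.colour s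
  map_move : ∀ s i x, toFun (A.move s i x) = B.move (toFun s) i x

namespace Hom

variable {A B D}

/-- The identity of a coloured system. -/
def id : Hom A A := ⟨fun s => s, fun _ => rfl, fun _ _ _ => rfl⟩

/-- The composition of homomorphisms of coloured systems. -/
def comp (ψ : Hom B D) (φ : Hom A B) : Hom A D where
  toFun s := ψ.toFun (φ.toFun s)
  colour_toFun s := (ψ.colour_toFun _).trans (φ.colour_toFun s)
  map_move s i x := by rw [φ.map_move, ψ.map_move]

theorem map_walk (ψ : Hom A B) (s : S) (w : List (Σ i, X i)) :
    ψ.toFun (A.walk s w) = B.walk (ψ.toFun s) w := by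
  induction w generalizing s with
  | nil => rfl
  | cons l w ih => rw [walk_cons, walk_cons, ih, ψ.map_move]

end Hom

open Classical in
/-- The covering of a coloured system by an abelian group `G` in which every move of type `i` adds
the variation of `φ` to the `G`-component. It is a coloured system if `φ` does not change under
moves whose type commutes with `i`. -/
noncomputable def voltageCover {G : Type*} [AddCommGroup G] (i : I) (φ : S → G)
    (hφ : ∀ s k x, M i k = 2 → φ (A.move s k x) = φ s) : ColouredSystem M X (S × G) where
  colour s := A.colour s.1
  move s k x := (A.move s.1 k x, if k = i then s.2 + (φ (A.move s.1 k x) - φ s.1) else s.2)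
  colour_move_same s := A.colour_move_same s.1
  colour_move_of_ne s := A.colour_move_of_ne s.1
  move_colour s k := by simp [A.move_colour]
  move_move s k x y := by
    rw [A.move_move]
    split_ifs
    · rw [add_assoc, add_comm (φ _ - φ _), sub_add_sub_cancel]
    · rfl
  move_comm s k l x y hkl := by
    have hlk : M l k = 2 := M.symmetric k l ▸ hkl
    rw [A.move_comm s.1 k l x y hkl]
    split_ifs with hl hk hk
    · exact absurd (hk.trans hl.symm) (ne_of_apply_eq_two hkl)
    · subst hl
      rw [hφ (A.move s.1 l y) k x hlk, hφ s.1 k x hlk]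
    · subst hk
      rw [hφ s.1 l y hkl, ← A.move_comm s.1 k l x y hkl, hφ _ l y hkl]
    · rfl

end ColouredSystem

namespace ChamberSystem

open RightAngledCoxeter

variable {I C : Type*} {M : CoxeterMatrix I} {Δ : ChamberSystem I C}

namespace IsBuilding

theorem exists_isGallery (hΔ : Δ.IsBuilding M) (c d : C) : ∃ ω, Δ.IsGallery ω c d := by
  obtain ⟨-, -, δ, hδ⟩ := hΔ
  obtain ⟨ω, hω, hωd⟩ := M.toCoxeterSystem.exists_isReduced (δ c d)
  exact ⟨ω, (hδ ω hω c d).1 hωd⟩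

theorem isGallery_of_wordProd_eq (hΔ : Δ.IsBuilding M) {ω ω' : List I}
    (hω : M.toCoxeterSystem.IsReduced ω) (hω' : M.toCoxeterSystem.IsReduced ω')
    (h : M.toCoxeterSystem.wordProd ω = M.toCoxeterSystem.wordProd ω') {c d : C}
    (hcd : Δ.IsGallery ω c d) : Δ.IsGallery ω' c d := by
  obtain ⟨-, -, δ, hδ⟩ := hΔ
  exact (hδ ω' hω' c d).1 (((hδ ω hω c d).2 hcd).trans h)

theorem eq_nil_of_isGallery_self (hΔ : Δ.IsBuilding M) {ω : List I}
    (hω : M.toCoxeterSystem.IsReduced ω) {c : C} (hc : Δ.IsGallery ω c c) : ω = [] := by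
  obtain ⟨-, -, δ, hδ⟩ := hΔ
  have hnil : M.toCoxeterSystem.IsReduced [] := by simp [CoxeterSystem.IsReduced]
  have hprod : M.toCoxeterSystem.wordProd ω = M.toCoxeterSystem.wordProd [] :=
    ((hδ ω hω c c).2 hc).symm.trans ((hδ [] hnil c c).2 rfl)
  rw [← List.length_eq_zero_iff, ← hω, hprod, hnil, List.length_nil]

theorem exists_adj_adj (hΔ : Δ.IsBuilding M) (hM : M.IsRightAngled) {i j : I} (hij : M i j = 2)
    {c e d : C} (hce : (Δ.adj i).r c e) (hed : (Δ.adj j).r e d) :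
    ∃ z, (Δ.adj j).r c z ∧ (Δ.adj i).r z d := by
  by_cases he : e = c
  · subst he
    exact ⟨d, hed, (Δ.adj i).refl d⟩
  by_cases hd : d = e
  · subst hd
    exact ⟨c, (Δ.adj j).refl c, hce⟩
  have hne : i ≠ j := ne_of_apply_eq_two hij
  have hgallery : Δ.IsGallery [j, i] c d := by
    refine hΔ.isGallery_of_wordProd_eq (isReduced_pair hM hne) (isReduced_pair hM hne.symm) ?_
      ⟨e, he, hce, d, hd, hed, rfl⟩
    simpa [CoxeterSystem.wordProd] using simple_mul_comm M.toCoxeterSystem hij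
  obtain ⟨z, -, hcz, _, -, hzd, rfl⟩ := hgallery
  exact ⟨z, hcz, hzd⟩

end IsBuilding

namespace LegalColouring

variable {X : I → Type*} (col : Δ.LegalColouring X)

/-- The chamber with `i`-th colour `x` in the `i`-panel of `c`. -/
noncomputable def move (c : C) (i : I) (x : X i) : C :=
  ((col.panelEquiv i c).symm x).1

theorem adj_move (c : C) (i : I) (x : X i) : (Δ.adj i).r c (col.move c i x) :=
  ((col.panelEquiv i c).symm x).2

theorem colour_move_same (c : C) (i : I) (x : X i) : col.colour (col.move c i x) i = x :=
  (col.panelEquiv i c).apply_symm_apply x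

theorem colour_move_of_ne (c : C) {i j : I} (x : X i) (hj : j ≠ i) :
    col.colour (col.move c i x) j = col.colour c j :=
  col.constant_panel i j hj c _ (col.adj_move c i x)

theorem move_eq {c d : C} {i : I} {x : X i} (hcd : (Δ.adj i).r c d) (hd : col.colour d i = x) :
    col.move c i x = d :=
  congrArg Subtype.val ((col.panelEquiv i c).symm_apply_eq.2 hd.symm :
    (col.panelEquiv i c).symm x = ⟨d, hcd⟩)

theorem move_comm (hΔ : Δ.IsBuilding M) (hM : M.IsRightAngled) (c : C) {i j : I} (x : X i)
    (y : X j) (hij : M i j = 2) :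
    col.move (col.move c i x) j y = col.move (col.move c j y) i x := by
  have hne : i ≠ j := ne_of_apply_eq_two hij
  obtain ⟨z, hcz, hzd⟩ := hΔ.exists_adj_adj hM hij (col.adj_move c i x)
    (col.adj_move (col.move c i x) j y)
  have hz : col.move c j y = z := by
    refine col.move_eq hcz ?_
    rw [← col.constant_panel i j hne.symm z _ hzd, col.colour_move_same]
  rw [hz]
  refine (col.move_eq hzd ?_).symm
  rw [col.colour_move_of_ne _ y hne, col.colour_move_same]

/-- The chambers of a legally coloured right-angled building as a coloured system. -/
noncomputable def colouredSystem (hΔ : Δ.IsBuilding M) (hM : M.IsRightAngled) :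
    ColouredSystem M X C where
  colour := col.colour
  move := col.move
  colour_move_same := col.colour_move_same
  colour_move_of_ne c _ _ x hj := col.colour_move_of_ne c x hj
  move_colour c i := col.move_eq ((Δ.adj i).refl c) rfl
  move_move c i x y := by
    refine (col.move_eq ?_ (col.colour_move_same _ i y)).symm
    exact (Δ.adj i).trans (col.adj_move c i x) (col.adj_move _ i y)
  move_comm c _ _ x y := col.move_comm hΔ hM c x y

section Walk

variable {S : Type*} (hΔ : Δ.IsBuilding M) (hM : M.IsRightAngled) {B : ColouredSystem M X S}

theorem exists_walk_eq (c d : C) : ∃ w, (col.colouredSystem hΔ hM).walk c w = d := by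
  obtain ⟨ω, hω⟩ := hΔ.exists_isGallery c d
  induction ω generalizing c with
  | nil => exact ⟨[], hω⟩
  | cons i ω ih =>
    obtain ⟨e, -, hce, hed⟩ := hω
    obtain ⟨w, hw⟩ := ih e hed
    refine ⟨⟨i, col.colour e i⟩ :: w, ?_⟩
    rw [ColouredSystem.walk_cons]
    exact (congrArg (fun z => (col.colouredSystem hΔ hM).walk z w) (col.move_eq hce rfl)).trans hw

theorem isGallery_walk {c : C} {w : List (Σ i, X i)}
    (hw : ∀ a l b, w = a ++ l :: b →
      col.colour ((col.colouredSystem hΔ hM).walk c a) l.1 ≠ l.2) :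
    Δ.IsGallery (w.map Sigma.fst) c ((col.colouredSystem hΔ hM).walk c w) := by
  induction w generalizing c with
  | nil => rfl
  | cons l w ih =>
    refine ⟨col.move c l.1 l.2, fun hc => hw [] l w rfl ?_, col.adj_move c l.1 l.2,
      ih fun a k b hab => hw (l :: a) k b (congrArg (l :: ·) hab)⟩
    calc col.colour c l.1 = col.colour (col.move c l.1 l.2) l.1 := by rw [hc]
      _ = l.2 := col.colour_move_same c l.1 l.2

theorem exists_isRedundant {c : C} {w : List (Σ i, X i)} (hne : w ≠ [])
    (hw : (col.colouredSystem hΔ hM).walk c w = c) :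
    ∃ a l b, w = a ++ l :: b ∧ (col.colouredSystem hΔ hM).IsRedundant
      ((col.colouredSystem hΔ hM).walk c a) l b := by
  by_contra! hirr
  have hgallery : Δ.IsGallery (w.map Sigma.fst) c c := by
    have h := col.isGallery_walk hΔ hM fun a l b hab hl => hirr a l b hab (Or.inl hl)
    rwa [hw] at h
  have hreduced : M.toCoxeterSystem.IsReduced (w.map Sigma.fst) := by
    by_contra hred
    obtain ⟨α, i, β, hαβ, hβ⟩ := exists_commutesToFront_of_not_isReduced hM hred
    obtain ⟨a, v, rfl, -, hv⟩ := List.map_eq_append_iff.1 hαβ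
    obtain ⟨l, b, rfl, rfl, rfl⟩ := List.map_eq_cons_iff.1 hv
    exact hirr a l b rfl (Or.inr hβ)
  exact hne (List.map_eq_nil_iff.1 (hΔ.eq_nil_of_isGallery_self hreduced hgallery))

/-- A closed walk contains a redundant move; whether a move is redundant depends only on colours,
so the move can be deleted in both systems. -/
theorem walk_eq_self {c : C} {s : S} (hs : (col.colouredSystem hΔ hM).colour c = B.colour s)
    {w : List (Σ i, X i)}
    (hw : (col.colouredSystem hΔ hM).walk c w = c) : B.walk s w = s := by
  induction hn : w.length using Nat.strong_induction_on generalizing w with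
  | _ n ih =>
    subst hn
    by_cases hne : w = []
    · rw [hne, B.walk_nil]
    obtain ⟨a, l, b, rfl, hl⟩ := col.exists_isRedundant hΔ hM hne hw
    have hlB : B.IsRedundant (B.walk s a) l b :=
      hl.congr (ColouredSystem.colour_walk_congr hs a)
    rw [ColouredSystem.walk_append, hl.walk_cons, ← ColouredSystem.walk_append] at hw
    rw [B.walk_append, hlB.walk_cons, ← B.walk_append]
    exact ih _ (by simp) hw rfl

theorem walk_eq_walk {c : C} {s : S} (hs : (col.colouredSystem hΔ hM).colour c = B.colour s)
    {w w' : List (Σ i, X i)}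
    (hw : (col.colouredSystem hΔ hM).walk c w = (col.colouredSystem hΔ hM).walk c w') :
    B.walk s w = B.walk s w' := by
  obtain ⟨r, hr⟩ := col.exists_walk_eq hΔ hM ((col.colouredSystem hΔ hM).walk c w) c
  have hback : B.walk (B.walk s w) r = s := by
    rw [← B.walk_append]
    exact col.walk_eq_self hΔ hM hs (by rw [ColouredSystem.walk_append, hr])
  have hforth : B.walk (B.walk s w) (r ++ w') = B.walk s w :=
    col.walk_eq_self hΔ hM (ColouredSystem.colour_walk_congr hs w)
      (by rw [ColouredSystem.walk_append, hr, hw])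
  rw [← hforth, B.walk_append, hback]

theorem exists_hom_toFun_eq {c : C} {s : S}
    (hs : (col.colouredSystem hΔ hM).colour c = B.colour s) :
    ∃ ψ : (col.colouredSystem hΔ hM).Hom B, ψ.toFun c = s := by
  choose w hw using col.exists_walk_eq hΔ hM c
  have hext (v : List (Σ i, X i)) :
      B.walk s (w ((col.colouredSystem hΔ hM).walk c v)) = B.walk s v :=
    col.walk_eq_walk hΔ hM hs (hw _)
  refine ⟨⟨fun d => B.walk s (w d), fun d => ?_, fun d i x => ?_⟩, hext []⟩
  · rw [← ColouredSystem.colour_walk_congr hs (w d), hw]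
  · have h := hext (w d ++ [⟨i, x⟩])
    rwa [ColouredSystem.walk_append, hw, B.walk_append] at h

theorem hom_toFun_eq {ψ φ : (col.colouredSystem hΔ hM).Hom B} {c : C}
    (hc : ψ.toFun c = φ.toFun c) (d : C) : ψ.toFun d = φ.toFun d := by
  obtain ⟨w, rfl⟩ := col.exists_walk_eq hΔ hM c d
  rw [ψ.map_walk, φ.map_walk, hc]

end Walk

section Automorphism

theorem adj_map_of_hom {hΔ : Δ.IsBuilding M} {hM : M.IsRightAngled}
    (ψ : (col.colouredSystem hΔ hM).Hom (col.colouredSystem hΔ hM)) {i : I} {c d : C}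
    (hcd : (Δ.adj i).r c d) : (Δ.adj i).r (ψ.toFun c) (ψ.toFun d) := by
  have hd : ψ.toFun d = col.move (ψ.toFun c) i (col.colour d i) :=
    (congrArg ψ.toFun (col.move_eq hcd rfl)).symm.trans (ψ.map_move c i (col.colour d i))
  rw [hd]
  exact col.adj_move (ψ.toFun c) i (col.colour d i)

theorem mem_universalGroup_of_colour_eq (F : (i : I) → Subgroup (Equiv.Perm (X i))) {g : Δ.aut}
    (hg : ∀ c, col.colour (g.1 c) = col.colour c) : g ∈ col.universalGroup F := by
  intro i c
  rw [col.localAction_ext (f := 1) fun d _ => congrFun (hg d) i]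
  exact (F i).one_mem

theorem exists_mem_universalGroup_apply_eq (hΔ : Δ.IsBuilding M) (hM : M.IsRightAngled)
    (F : (i : I) → Subgroup (Equiv.Perm (X i))) {c d : C} (hcd : col.colour c = col.colour d) :
    ∃ g ∈ col.universalGroup F, g.1 c = d := by
  obtain ⟨ψ, hψ⟩ := col.exists_hom_toFun_eq hΔ hM (B := col.colouredSystem hΔ hM) hcd
  obtain ⟨φ, hφ⟩ := col.exists_hom_toFun_eq hΔ hM (B := col.colouredSystem hΔ hM) hcd.symm
  have hφψ : ∀ e, φ.toFun (ψ.toFun e) = e :=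
    col.hom_toFun_eq hΔ hM (ψ := φ.comp ψ) (φ := .id) ((congrArg φ.toFun hψ).trans hφ)
  have hψφ : ∀ e, ψ.toFun (φ.toFun e) = e :=
    col.hom_toFun_eq hΔ hM (ψ := ψ.comp φ) (φ := .id) ((congrArg ψ.toFun hφ).trans hψ)
  refine ⟨⟨⟨ψ.toFun, φ.toFun, hφψ, hψφ⟩, fun i e e' => ⟨fun h => ?_, col.adj_map_of_hom ψ⟩⟩,
    col.mem_universalGroup_of_colour_eq F ψ.colour_toFun, hψ⟩
  simpa only [Equiv.coe_fn_mk, hφψ] using col.adj_map_of_hom φ h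

end Automorphism

section ConnectedOutside

variable {i : I} {O : Set (X i)}

/-- The function `h` is the `G`-component of a lift of the building to a voltage cover. -/
theorem exists_height (hΔ : Δ.IsBuilding M) (hM : M.IsRightAngled) {G : Type*} [AddCommGroup G]
    {j : I} (hij : M i j ≠ 2) (f : X i → X j → G) :
    ∃ h : C → G, (∀ k c d, k ≠ i → (Δ.adj k).r c d → h d = h c) ∧ ∀ c d, (Δ.adj i).r c d →
      h d = h c + (f (col.colour d i) (col.colour d j) - f (col.colour c i) (col.colour c j)) := by
  classical
  let φ : C → G := fun c => f (col.colour c i) (col.colour c j)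
  have hφ (c : C) (k : I) (x : X k) (hik : M i k = 2) : φ (col.move c k x) = φ c := by
    have hjk : j ≠ k := fun hjk => hij (hjk ▸ hik)
    have hik' : i ≠ k := ne_of_apply_eq_two hik
    simp only [φ, col.colour_move_of_ne c x hik', col.colour_move_of_ne c x hjk]
  obtain ⟨c₀⟩ := hΔ.1
  obtain ⟨ψ, -⟩ := col.exists_hom_toFun_eq hΔ hM (c := c₀) (s := (c₀, 0))
    (B := (col.colouredSystem hΔ hM).voltageCover i φ hφ) rfl
  have hφψ (c : C) : φ (ψ.toFun c).1 = φ c :=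
    congrArg (fun κ => f (κ i) (κ j)) (ψ.colour_toFun c)
  have hψ {k : I} {c d : C} (hcd : (Δ.adj k).r c d) :
      (ψ.toFun d).2 = if k = i then (ψ.toFun c).2 + (φ d - φ c) else (ψ.toFun c).2 := by
    have hmove := (congrArg ψ.toFun (col.move_eq hcd rfl)).symm.trans
      (ψ.map_move c k (col.colour d k))
    rw [← hφψ d, ← hφψ c, hmove]
    simp only [ColouredSystem.voltageCover]
  exact ⟨fun c => (ψ.toFun c).2, fun k c d hk hcd => (hψ hcd).trans (if_neg hk),
    fun c d hcd => (hψ hcd).trans (if_pos rfl)⟩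

/-- The equivalence relation of being joined by a gallery all of whose chambers have their `i`-th
colour outside `O`; it is trivial on the other chambers. -/
def connectedOutside (i : I) (O : Set (X i)) : Setoid C :=
  Relation.EqvGen.setoid fun c d =>
    col.colour c i ∉ O ∧ col.colour d i ∉ O ∧ ∃ k, (Δ.adj k).r c d

theorem exists_finite_connectedOutside (hΔ : Δ.IsBuilding M) (i : I) (c d : C) :
    ∃ Y : Set (X i), Y.Finite ∧ col.colour c i ∈ Y ∧
      ∀ O, Disjoint Y O → col.connectedOutside i O c d := by
  obtain ⟨ω, hω⟩ := hΔ.exists_isGallery c d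
  induction ω generalizing c with
  | nil => exact ⟨{col.colour c i}, Set.finite_singleton _, rfl, fun O _ => hω ▸ Setoid.refl' _ c⟩
  | cons k ω ih =>
    obtain ⟨e, -, hce, hed⟩ := hω
    obtain ⟨Y, hY, heY, hYO⟩ := ih e hed
    refine ⟨insert (col.colour c i) Y, hY.insert _, Set.mem_insert _ _, fun O hO => ?_⟩
    obtain ⟨hc, hdisj⟩ := Set.disjoint_insert_left.1 hO
    exact Setoid.trans' _ (.rel _ _ ⟨hc, Set.disjoint_left.1 hdisj heY, k, hce⟩) (hYO O hdisj)

theorem connectedOutside_map {F : (i : I) → Subgroup (Equiv.Perm (X i))}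
    (hO : ∀ f ∈ F i, ∀ x, f x ∈ O ↔ x ∈ O) {g : Δ.aut} (hg : g ∈ col.universalGroup F) {c d : C}
    (hcd : col.connectedOutside i O c d) : col.connectedOutside i O (g.1 c) (g.1 d) := by
  have hcolour (c : C) : col.colour (g.1 c) i ∈ O ↔ col.colour c i ∈ O := by
    rw [← col.localAction_colour g i c c ((Δ.adj i).refl c)]
    exact hO _ (hg i c) _
  have hle : col.connectedOutside i O ≤ (col.connectedOutside i O).comap g.1 :=
    Setoid.eqvGen_le fun c d ⟨hc, hd, k, hk⟩ =>
      .rel _ _ ⟨mt (hcolour c).1 hc, mt (hcolour d).1 hd, k, (g.2 k c d).2 hk⟩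
  exact hle hcd

theorem exists_colour_ne (hΔ : Δ.IsBuilding M) (c : C) (j : I) : ∃ y, y ≠ col.colour c j := by
  obtain ⟨d, hd, hdc⟩ := hΔ.2.1 j c
  refine ⟨col.colour d j, fun h => hdc ?_⟩
  rw [← col.move_eq hd h, col.move_eq ((Δ.adj j).refl c) rfl]

/-- A height that counts the crossings, by moves of type `i` in panels of a fixed `j`-th colour `y`,
into `O` is constant on the classes of `connectedOutside`. Moves of types `i`, `j`, `i`, `j` that
change two colours of `c` and then restore them enter `O` at another `j`-th colour, but leave it at
`y`. -/
theorem exists_not_connectedOutside (hΔ : Δ.IsBuilding M) (hM : M.IsRightAngled) {j : I}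
    (hji : j ≠ i) (hij : M i j ≠ 2) {c : C} (hO : O.Nonempty) (hc : col.colour c i ∉ O) :
    ∃ d, col.colour c = col.colour d ∧ ¬ col.connectedOutside i O c d := by
  classical
  obtain ⟨x, hx⟩ := hO
  obtain ⟨y, hy⟩ := col.exists_colour_ne hΔ c j
  obtain ⟨h, hne, hi⟩ := col.exists_height hΔ hM hij
    fun (a : X i) (b : X j) => if a ∈ O ∧ b = y then (1 : ℤ) else 0
  have hconst : col.connectedOutside i O ≤ Setoid.ker h := by
    refine Setoid.eqvGen_le fun d e ⟨hd, he, k, hde⟩ => Eq.symm ?_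
    obtain rfl | hk := eq_or_ne k i
    · simpa only [hd, he, false_and, if_false, sub_zero, add_zero] using hi d e hde
    · exact hne k d e hk hde
  have hmove_i (c : C) (a : X i) := hi c _ (col.adj_move c i a)
  have hmove_j (c : C) (b : X j) : h (col.move c j b) = h c := hne j c _ hji (col.adj_move c j b)
  let d := col.move (col.move (col.move (col.move c i x) j y) i (col.colour c i)) j (col.colour c j)
  have hd : h d = h c - 1 := by
    simp [d, hmove_i, hmove_j, col.colour_move_of_ne _ _ hji, col.colour_move_of_ne _ _ hji.symm,
      col.colour_move_same, hx, hy.symm, hc, sub_eq_add_neg]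
  refine ⟨d, ((col.colouredSystem hΔ hM).colour_move_move_move_move hji c x y).symm, fun hcd => ?_⟩
  have hcd_height : h c = h d := hconst hcd
  omega

end ConnectedOutside

section Orbits

variable {F : (i : I) → Subgroup (Equiv.Perm (X i))} {K : Set (col.universalGroup F)}

theorem exists_mem_not_connectedOutside (hΔ : Δ.IsBuilding M) (hM : M.IsRightAngled)
    (hK : Subgroup.closure K = ⊤) {i j : I} (hji : j ≠ i) (hij : M i j ≠ 2) {O : Set (X i)}
    (hO : O.Nonempty) (hFO : ∀ f ∈ F i, ∀ x, f x ∈ O ↔ x ∈ O) {c : C}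
    (hc : col.colour c i ∉ O) : ∃ g ∈ K, ¬ col.connectedOutside i O c (g • c) := by
  by_contra! hconn
  obtain ⟨d, hd, hcd⟩ := col.exists_not_connectedOutside hΔ hM hji hij hO hc
  obtain ⟨g, hg, rfl⟩ := col.exists_mem_universalGroup_apply_eq hΔ hM F hd
  exact hcd (rel_smul_of_closure_eq_top hK
    (fun g _ _ => col.connectedOutside_map hFO g.2) hconn ⟨g, hg⟩)

theorem finite_orbits_of_closure_eq_top (hΔ : Δ.IsBuilding M) (hM : M.IsRightAngled)
    (hK : Subgroup.closure K = ⊤) {c : C} (hKc : ((· • c) '' K).Finite) {i j : I} (hji : j ≠ i)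
    (hij : M i j ≠ 2) : Finite (MulAction.orbitRel.Quotient (F i) (X i)) := by
  choose Y hYfin _ hYconn using col.exists_finite_connectedOutside hΔ i c
  let Z : Set (X i) := ⋃ d ∈ (· • c) '' K, Y d
  have hZ : (insert (col.colour c i) Z).Finite := (hKc.biUnion fun d _ => hYfin d).insert _
  by_contra hinf
  have : Infinite (MulAction.orbitRel.Quotient (F i) (X i)) := not_finite_iff_infinite.1 hinf
  let orbitOf : X i → MulAction.orbitRel.Quotient (F i) (X i) := Quotient.mk''
  obtain ⟨q, hq⟩ := (hZ.image orbitOf).exists_notMem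
  have hdisj : Disjoint (insert (col.colour c i) Z) q.orbit :=
    Set.disjoint_left.2 fun x hx hxq =>
      hq ⟨x, hx, MulAction.orbitRel.Quotient.mem_orbit.1 hxq⟩
  obtain ⟨hc, hZq⟩ := Set.disjoint_insert_left.1 hdisj
  have hFq (f) (hf : f ∈ F i) (x) : f x ∈ q.orbit ↔ x ∈ q.orbit := by
    rw [MulAction.orbitRel.Quotient.mem_orbit, MulAction.orbitRel.Quotient.mem_orbit]
    exact Eq.congr_left (MulAction.orbitRel.Quotient.quotient_smul_eq (g := (⟨f, hf⟩ : F i)))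
  obtain ⟨g, hg, hnot⟩ :=
    col.exists_mem_not_connectedOutside hΔ hM hK hji hij q.nonempty_orbit hFq hc
  have hgZ : Y (g • c) ⊆ Z := Set.subset_biUnion_of_mem (Set.mem_image_of_mem (· • c) hg)
  exact hnot (hYconn (g • c) q.orbit (hZq.mono_left hgZ))

end Orbits

end LegalColouring

end ChamberSystem

theorem mainTheorem5_general {I C : Type*} {M : CoxeterMatrix I} (hM : M.IsRightAngled)
    {Δ : ChamberSystem I C} (hΔ : Δ.IsBuilding M) {X : I → Type*} (col : Δ.LegalColouring X)
    (F : (i : I) → Subgroup (Equiv.Perm (X i)))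
    (hcg : IsCompactlyGeneratedGroup (col.universalGroup F)) {i j : I} (hji : j ≠ i)
    (hij : M i j ≠ 2) : Finite (MulAction.orbitRel.Quotient (F i) (X i)) := by
  obtain ⟨K, hK, hgen⟩ := hcg
  obtain ⟨c⟩ := hΔ.1
  have hval : Continuous fun g : col.universalGroup F => g.1.1 :=
    continuous_subtype_val.comp continuous_subtype_val
  have hKc := finite_image_apply_of_isCompact (hK.image hval) c
  rw [Set.image_image] at hKc
  exact col.finite_orbits_of_closure_eq_top hΔ hM hgen hKc hji hij

theorem mainTheorem5 {I C : Type*} [Finite I] (M : CoxeterMatrix I)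
    (hM : M.IsRightAngled) (hiso : M.HasNoIsolatedNodes)
    (Δ : ChamberSystem I C) (hΔ : Δ.IsBuilding M)
    {X : I → Type*} (col : Δ.LegalColouring X)
    (F : (i : I) → Subgroup (Equiv.Perm (X i)))
    (hclosed : IsClosed (col.universalGroup F : Set Δ.aut))
    (hlc : LocallyCompactSpace (col.universalGroup F))
    (hcg : IsCompactlyGeneratedGroup (col.universalGroup F)) :
    ∀ i, Finite (MulAction.orbitRel.Quotient (F i) (X i)) := fun i =>
  let ⟨_, hji, hij⟩ := hiso i
  mainTheorem5_general hM hΔ col F hcg hji hij
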